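/- Let $X$ be a finite set with $n \ge 5$ elements and let $\tau$ be a topology on $X$ having at least $6\cdot 2^{n-4}$ open sets. For $0 \le j \le n$ let $u_j$ be the number of open sets of $\tau$ with exactly $j$ elements, and let $P(x)=\sum_{j=0}^{n} u_j x^j$ be the open set polynomial of $\tau$. Then $P$ is unimodal: its coefficients $u_0,\dots,u_n$ are all positive, and there are integers $0 \le k_0 \le k_1 \le n$ such that $$u_0 \le u_1 \le \cdots \le u_{k_0} = u_{k_0+1} = \cdots = u_{k_1} \ge u_{k_1+1} \ge \cdots \ge u_n .$$ -/

import Mathlib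

open scoped Topology

noncomputable section

/-- The number `u_j` of open sets with exactly `j` elements. -/
def openSetCount {X : Type*} (τ : TopologicalSpace X) (j : ℕ) : ℕ :=
  {U : Set X | IsOpen[τ] U ∧ U.ncard = j}.ncard

/-- The open set polynomial `∑_{j=0}^{n} u_j x^j` of a topology on a set with `n` elements. -/
def openSetPolynomial {X : Type*} (τ : TopologicalSpace X) : Polynomial ℝ :=
  ∑ j ∈ Finset.range (Nat.card X + 1),
    Polynomial.C (openSetCount τ j : ℝ) * Polynomial.X ^ j

/-- A finite positive sequence `a_0, …, a_n` is unimodal if, for some `k₀ ≤ k₁ ≤ n`,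
`a_0 ≤ ⋯ ≤ a_{k₀} = ⋯ = a_{k₁} ≥ ⋯ ≥ a_n`. -/
def IsUnimodalSeq (n : ℕ) (a : ℕ → ℝ) : Prop :=
  (∀ j ≤ n, 0 < a j) ∧
  ∃ k₀ k₁ : ℕ, k₀ ≤ k₁ ∧ k₁ ≤ n ∧
    (∀ j, j < k₀ → a j ≤ a (j + 1)) ∧
    (∀ j, k₀ ≤ j → j < k₁ → a j = a (j + 1)) ∧
    (∀ j, k₁ ≤ j → j < n → a (j + 1) ≤ a j)

/-- A real polynomial is unimodal if the sequence of its coefficients is unimodal. -/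
def IsUnimodalPolynomial (p : Polynomial ℝ) : Prop :=
  IsUnimodalSeq p.natDegree p.coeff

end

/-! Open sets of a finite space are the lower sets of its specialization preorder, and the threshold
says that they make up at least 3/8 of all subsets. This density cannot drop on passing to a subset
of the points, since each added point at most doubles the number of lower sets.

A point comparable to no other contributes a factor `1 + X`, which preserves unimodality, so for at
least seven points the comparability graph may be assumed to have no isolated vertex. An edge has
density at most 3/4, a path on three vertices at most 5/8, and densities multiply over unions. Hence
three disjoint edges are impossible (`not_three_pairs`), two stars cover everything
(`exists_dominating_pair`), and some point `x` has at least four neighbours (`exists_large_degree`).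
Counting lower sets with and without `x` shows that `x` is minimal or maximal; complementation
reduces to the minimal case. There the points other than `x` have density above 5/8, hence at most
one comparability, and the polynomial is explicit up to factors `1 + X` (`unimodal_of_minimal`).

Five and six points are settled by an enumeration of all families of lower sets of sufficient
density, built one point at a time (`exists_mem_families`). -/

open Polynomial

/-- The coefficients of `p` are positive exactly up to index `n`, and they are unimodal. -/
def UnimodalUpTo (p : ℕ[X]) (n : ℕ) : Prop :=
  (∀ j ≤ n, 0 < p.coeff j) ∧ (∀ j, n < j → p.coeff j = 0) ∧
    ∃ k, (∀ j < k, p.coeff j ≤ p.coeff (j + 1)) ∧ ∀ j, k ≤ j → p.coeff (j + 1) ≤ p.coeff j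

/-! ### Operations that preserve unimodal coefficients. -/

namespace UnimodalUpTo

variable {p q : ℕ[X]} {n : ℕ}

/-- Sums of neighbouring coefficients still rise up to the old mode `k` and fall from `k + 1` on.
Only the step from `k` to `k + 1` is undetermined, and either outcome gives a mode. -/
theorem mul_one_add_X (h : UnimodalUpTo p n) : UnimodalUpTo (p * (1 + X)) (n + 1) := by
  obtain ⟨hpos, hzero, k, hup, hdown⟩ := h
  have h0 : (p * (1 + X)).coeff 0 = p.coeff 0 := by simp [mul_add]
  have hs : ∀ j, (p * (1 + X)).coeff (j + 1) = p.coeff (j + 1) + p.coeff j := by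
    intro j; simp [mul_add]
  refine ⟨?_, ?_, ?_⟩
  · rintro (_ | j) hj
    · rw [h0]; exact hpos 0 (Nat.zero_le _)
    · rw [hs]; have := hpos j (by omega); omega
  · rintro (_ | j) hj
    · omega
    · rw [hs, hzero j (by omega), hzero (j + 1) (by omega)]
  · have hup' : ∀ j < k, (p * (1 + X)).coeff j ≤ (p * (1 + X)).coeff (j + 1) := by
      rintro (_ | j) hj
      · rw [h0, hs]; omega
      · rw [hs, hs]; have := hup _ hj; have := hup j (by omega); omega
    have hdown' : ∀ j, k + 1 ≤ j → (p * (1 + X)).coeff (j + 1) ≤ (p * (1 + X)).coeff j := by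
      rintro (_ | j) hj
      · omega
      · rw [hs, hs]; have := hdown (j + 1) (by omega); have := hdown j (by omega); omega
    rcases le_total ((p * (1 + X)).coeff k) ((p * (1 + X)).coeff (k + 1)) with hk | hk
    · refine ⟨k + 1, fun j hj => ?_, hdown'⟩
      rcases Nat.lt_succ_iff_lt_or_eq.1 hj with hj | rfl
      · exact hup' j hj
      · exact hk
    · refine ⟨k, hup', fun j hj => ?_⟩
      rcases Nat.eq_or_lt_of_le hj with rfl | hj
      · exact hk
      · exact hdown' j hj

theorem mul_one_add_X_pow (h : UnimodalUpTo p n) (m : ℕ) :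
    UnimodalUpTo (p * (1 + X) ^ m) (n + m) := by
  induction m with
  | zero => simpa using h
  | succ m ih => rw [pow_succ, ← mul_assoc]; exact ih.mul_one_add_X

theorem one : UnimodalUpTo 1 0 := by
  refine ⟨?_, ?_, 0, ?_, ?_⟩
  · intro j hj; obtain rfl : j = 0 := by omega
    simp
  · intro j hj; rw [coeff_one, if_neg (by omega)]
  · intro j hj; omega
  · intro j _; rw [coeff_one, if_neg (by omega)]; omega

theorem coeff_one_add_X_add_sq (j : ℕ) :
    (1 + X + X ^ 2 : ℕ[X]).coeff j = if j ≤ 2 then 1 else 0 := by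
  rcases j with _ | _ | _ | j <;> simp [coeff_one, coeff_X, coeff_X_pow]

theorem one_add_X_add_sq : UnimodalUpTo (1 + X + X ^ 2) 2 := by
  refine ⟨?_, ?_, 0, ?_, ?_⟩
  · intro j hj; rw [coeff_one_add_X_add_sq, if_pos hj]; exact one_pos
  · intro j hj; rw [coeff_one_add_X_add_sq, if_neg (by omega)]
  · intro j hj; omega
  · intro j _; simp only [coeff_one_add_X_add_sq]; split_ifs <;> omega

theorem X_mul_add_one (h : UnimodalUpTo q n) : UnimodalUpTo (X * q + 1) (n + 1) := by
  obtain ⟨hpos, hzero, k, hup, hdown⟩ := h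
  have hs : ∀ j, (X * q + 1).coeff (j + 1) = q.coeff j := by
    intro j; simp [coeff_one]
  have h0 : (X * q + 1).coeff 0 = 1 := by simp
  refine ⟨?_, ?_, k + 1, ?_, ?_⟩
  · rintro (_ | j) hj
    · rw [h0]; omega
    · rw [hs]; exact hpos j (by omega)
  · rintro (_ | j) hj
    · omega
    · rw [hs]; exact hzero j (by omega)
  · rintro (_ | j) hj
    · rw [h0, hs]; exact hpos 0 (Nat.zero_le _)
    · rw [hs, hs]; exact hup j (by omega)
  · rintro (_ | j) hj
    · omega
    · rw [hs, hs]; exact hdown j (by omega)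

/-- The sum has coefficients `1, q₀ + 1, q₁ + 1, q₂, q₃, …`, so the only new inequality needed is
`q₁ + 1 ≤ q₂`; it also forces the mode of `q` to be at least 2. -/
theorem X_mul_add_one_add_X_add_sq (h : UnimodalUpTo q n) (hn : 1 ≤ n)
    (hq : q.coeff 1 + 1 ≤ q.coeff 2) : UnimodalUpTo (X * q + (1 + X + X ^ 2)) (n + 1) := by
  obtain ⟨hpos, hzero, k, hup, hdown⟩ := h
  have hs : ∀ j, (X * q + (1 + X + X ^ 2)).coeff (j + 1) = q.coeff j + if j ≤ 1 then 1 else 0 := by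
    intro j
    rw [coeff_add, coeff_X_mul, coeff_one_add_X_add_sq]
    simp
  have h0 : (X * q + (1 + X + X ^ 2)).coeff 0 = 1 := by
    rw [coeff_add, coeff_one_add_X_add_sq]; simp
  have hk : 2 ≤ k := by
    by_contra hk
    have := hdown 1 (by omega)
    norm_num at this
    omega
  refine ⟨?_, ?_, k + 1, ?_, ?_⟩
  · rintro (_ | j) hj
    · rw [h0]; omega
    · rw [hs]; have := hpos j (by omega); omega
  · rintro (_ | j) hj
    · omega
    · rw [hs, hzero j (by omega), if_neg (by omega)]
  · rintro (_ | _ | _ | j) hj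
    · rw [h0, hs]; simp
    · rw [hs, hs]; have := hup 0 (by omega); simpa using this
    · rw [hs, hs]; simpa using hq
    · rw [hs, hs, if_neg (by omega), if_neg (by omega)]; exact hup _ (by omega)
  · rintro (_ | j) hj
    · omega
    · rw [hs, hs, if_neg (by omega)]; have := hdown j (by omega); omega

theorem reverse (h : UnimodalUpTo p n) (hq : ∀ j ≤ n, q.coeff j = p.coeff (n - j))
    (hq' : ∀ j, n < j → q.coeff j = 0) : UnimodalUpTo q n := by
  obtain ⟨hpos, hzero, k, hup, hdown⟩ := h
  refine ⟨fun j hj => by rw [hq j hj]; exact hpos _ (by omega), hq', n - k, ?_, ?_⟩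
  · intro j hj
    rw [hq j (by omega), hq (j + 1) (by omega)]
    have := hdown (n - (j + 1)) (by omega)
    rwa [show n - (j + 1) + 1 = n - j by omega] at this
  · intro j hj
    rcases lt_or_ge j n with hjn | hjn
    · rw [hq j (by omega), hq (j + 1) (by omega)]
      have := hup (n - (j + 1)) (by omega)
      rwa [show n - (j + 1) + 1 = n - j by omega] at this
    · rw [hq' (j + 1) (by omega)]; omega

end UnimodalUpTo

/-! ### Lower sets, their generating polynomial and counting bounds. -/

namespace LowerSets
open scoped Classical

variable {α : Type*} (r : α → α → Prop)

/-- The subsets of `S` that are downward closed in `S` for the relation `r`. -/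
noncomputable def lowerSets (S : Finset α) : Finset (Finset α) :=
  S.powerset.filter fun U => ∀ a ∈ U, ∀ b ∈ S, r b a → b ∈ U

/-- The generating polynomial of the cardinalities of the downward closed subsets of `S`. -/
noncomputable def lowerPoly (S : Finset α) : ℕ[X] := ∑ U ∈ lowerSets r S, X ^ U.card

/-- The elements of `S` below `x`. -/
noncomputable def down (S : Finset α) (x : α) : Finset α := S.filter fun y => r y x

/-- The elements of `S` above `x`. -/
noncomputable def up (S : Finset α) (x : α) : Finset α := S.filter fun y => r x y

/-- Two distinct elements related by `r`, in some direction. -/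
def Adj (a b : α) : Prop := a ≠ b ∧ (r a b ∨ r b a)

variable {r} {S T : Finset α} {x : α}

theorem Adj.symm {a b : α} (h : Adj r a b) : Adj r b a := ⟨h.1.symm, h.2.symm⟩

theorem mem_lowerSets {U : Finset α} :
    U ∈ lowerSets r S ↔ U ⊆ S ∧ ∀ a ∈ U, ∀ b ∈ S, r b a → b ∈ U := by
  simp [lowerSets]

theorem mem_down {y : α} : y ∈ down r S x ↔ y ∈ S ∧ r y x := by simp [down]

theorem mem_up {y : α} : y ∈ up r S x ↔ y ∈ S ∧ r x y := by simp [up]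

theorem coeff_lowerPoly (j : ℕ) :
    (lowerPoly r S).coeff j = ((lowerSets r S).filter fun U => U.card = j).card := by
  simp only [lowerPoly, finsetSum_coeff, coeff_X_pow, Finset.card_filter]
  exact Finset.sum_congr rfl fun U _ => by simp [eq_comm]

theorem eval_one_lowerPoly : (lowerPoly r S).eval 1 = (lowerSets r S).card := by
  simp [lowerPoly, eval_finsetSum]

/-- Lower sets containing `x` contain everything below it, which can be removed; lower sets avoiding
`x` avoid everything above it. -/
theorem lowerPoly_eq [IsPreorder α r] (hx : x ∈ S) :
    lowerPoly r S =
      X ^ (down r S x).card * lowerPoly r (S \ down r S x) + lowerPoly r (S \ up r S x) := by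
  rw [lowerPoly, ← Finset.sum_filter_add_sum_filter_not (lowerSets r S) (fun U => x ∈ U)]
  congr 1
  · have hsub : ∀ U ∈ (lowerSets r S).filter (fun U => x ∈ U), down r S x ⊆ U := by
      intro U hU y hy
      rw [Finset.mem_filter, mem_lowerSets] at hU
      rw [mem_down] at hy
      exact hU.1.2 x hU.2 y hy.1 hy.2
    rw [lowerPoly, Finset.mul_sum]
    refine Finset.sum_nbij' (fun U => U \ down r S x) (fun V => V ∪ down r S x) ?_ ?_ ?_ ?_ ?_
    · intro U hU
      rw [Finset.mem_filter, mem_lowerSets] at hU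
      rw [mem_lowerSets]
      refine ⟨Finset.sdiff_subset_sdiff hU.1.1 subset_rfl, fun a ha b hb hba => ?_⟩
      rw [Finset.mem_sdiff] at ha hb ⊢
      exact ⟨hU.1.2 a ha.1 b hb.1 hba, hb.2⟩
    · intro V hV
      rw [mem_lowerSets] at hV
      rw [Finset.mem_filter, mem_lowerSets]
      refine ⟨⟨Finset.union_subset (hV.1.trans Finset.sdiff_subset) (Finset.filter_subset _ _),
        fun a ha b hb hba => ?_⟩, Finset.mem_union_right _ (mem_down.2 ⟨hx, refl_of r x⟩)⟩
      rw [Finset.mem_union] at ha ⊢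
      by_cases hbx : b ∈ down r S x
      · exact Or.inr hbx
      · rcases ha with ha | ha
        · exact Or.inl (hV.2 a ha b (Finset.mem_sdiff.2 ⟨hb, hbx⟩) hba)
        · exact Or.inr (mem_down.2 ⟨hb, trans_of r hba (mem_down.1 ha).2⟩)
    · intro U hU
      exact Finset.sdiff_union_of_subset (hsub U hU)
    · intro V hV
      rw [mem_lowerSets] at hV
      refine Finset.union_sdiff_cancel_right ?_
      exact Finset.disjoint_of_subset_left hV.1 Finset.sdiff_disjoint
    · intro U hU
      rw [← pow_add, add_comm, Finset.card_sdiff_add_card_eq_card (hsub U hU)]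
  · rw [lowerPoly]
    refine Finset.sum_congr ?_ fun _ _ => rfl
    ext U
    simp only [Finset.mem_filter, mem_lowerSets]
    constructor
    · rintro ⟨⟨hUS, hU⟩, hxU⟩
      refine ⟨fun a ha => Finset.mem_sdiff.2 ⟨hUS ha, fun hau => hxU ?_⟩, fun a ha b hb => ?_⟩
      · exact hU a ha x hx (mem_up.1 hau).2
      · exact hU a ha b (Finset.mem_sdiff.1 hb).1
    · rintro ⟨hUS, hU⟩
      refine ⟨⟨hUS.trans Finset.sdiff_subset, fun a ha b hb hba => ?_⟩, fun hxU => ?_⟩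
      · refine hU a ha b (Finset.mem_sdiff.2 ⟨hb, fun hbu => ?_⟩) hba
        have ha' := Finset.mem_sdiff.1 (hUS ha)
        exact ha'.2 (mem_up.2 ⟨ha'.1, trans_of r (mem_up.1 hbu).2 hba⟩)
      · exact (Finset.mem_sdiff.1 (hUS hxU)).2 (mem_up.2 ⟨hx, refl_of r x⟩)

theorem card_lowerSets_eq [IsPreorder α r] (hx : x ∈ S) :
    (lowerSets r S).card =
      (lowerSets r (S \ down r S x)).card + (lowerSets r (S \ up r S x)).card := by
  simp only [← eval_one_lowerPoly]
  conv_lhs => rw [lowerPoly_eq hx]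
  simp

theorem card_lowerSets_le_two_pow : (lowerSets r S).card ≤ 2 ^ S.card := by
  rw [← Finset.card_powerset]
  exact Finset.card_le_card (Finset.filter_subset _ _)

theorem inter_mem_lowerSets {U : Finset α} (hU : U ∈ lowerSets r S) (hT : T ⊆ S) :
    U ∩ T ∈ lowerSets r T := by
  rw [mem_lowerSets] at hU ⊢
  refine ⟨Finset.inter_subset_right, fun a ha b hb hba => ?_⟩
  exact Finset.mem_inter.2 ⟨hU.2 a (Finset.mem_inter.1 ha).1 b (hT hb) hba, hb⟩

/-- A lower set of the union is determined by its traces on the two parts, which need not be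
disjoint. -/
theorem card_lowerSets_union_le :
    (lowerSets r (S ∪ T)).card ≤ (lowerSets r S).card * (lowerSets r T).card := by
  rw [← Finset.card_product]
  refine Finset.card_le_card_of_injOn (fun U => (U ∩ S, U ∩ T)) ?_ ?_
  · intro U hU
    exact Finset.mem_product.2 ⟨inter_mem_lowerSets hU Finset.subset_union_left,
      inter_mem_lowerSets hU Finset.subset_union_right⟩
  · intro U hU V hV h
    have hU' := (mem_lowerSets.1 (Finset.mem_coe.1 hU)).1
    have hV' := (mem_lowerSets.1 (Finset.mem_coe.1 hV)).1
    rw [← Finset.inter_eq_left.2 hU', ← Finset.inter_eq_left.2 hV', Finset.inter_union_distrib_left,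
      Finset.inter_union_distrib_left, (Prod.mk.inj h).1, (Prod.mk.inj h).2]

theorem card_lowerSets_le_mul (hT : T ⊆ S) :
    (lowerSets r S).card ≤ (lowerSets r T).card * 2 ^ (S.card - T.card) := by
  conv_lhs => rw [← Finset.union_sdiff_of_subset hT]
  refine card_lowerSets_union_le.trans (Nat.mul_le_mul_left _ ?_)
  rw [← Finset.card_sdiff_of_subset hT]
  exact card_lowerSets_le_two_pow

/-- Complementation exchanges lower sets of `r` and of the reversed relation. -/
theorem coeff_lowerPoly_swap {j : ℕ} (hj : j ≤ S.card) :
    (lowerPoly r S).coeff j = (lowerPoly (Function.swap r) S).coeff (S.card - j) := by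
  rw [coeff_lowerPoly, coeff_lowerPoly]
  have key : ∀ (r : α → α → Prop) (i : ℕ), i ≤ S.card →
      ∀ U ∈ (lowerSets r S).filter (fun U => U.card = i),
      S \ U ∈ (lowerSets (Function.swap r) S).filter (fun U => U.card = S.card - i) := by
    intro r i _ U hU
    rw [Finset.mem_filter, mem_lowerSets] at hU ⊢
    refine ⟨⟨Finset.sdiff_subset, fun a ha b hb hba => ?_⟩, ?_⟩
    · rw [Finset.mem_sdiff] at ha ⊢
      exact ⟨hb, fun hbU => ha.2 (hU.1.2 b hbU a ha.1 hba)⟩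
    · rw [Finset.card_sdiff_of_subset hU.1.1, hU.2]
  refine Finset.card_nbij' (fun U => S \ U) (fun U => S \ U) (key r j hj) ?_ ?_ ?_
  · intro U hU
    have := key (Function.swap r) (S.card - j) (Nat.sub_le _ _) U hU
    rwa [Nat.sub_sub_self hj] at this
  · intro U hU
    exact Finset.sdiff_sdiff_eq_self (mem_lowerSets.1 (Finset.mem_filter.1 hU).1).1
  · intro U hU
    exact Finset.sdiff_sdiff_eq_self (mem_lowerSets.1 (Finset.mem_filter.1 hU).1).1

theorem coeff_lowerPoly_eq_zero {j : ℕ} (hj : S.card < j) : (lowerPoly r S).coeff j = 0 := by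
  rw [coeff_lowerPoly, Finset.card_eq_zero, Finset.filter_eq_empty_iff]
  intro U hU h
  have := Finset.card_le_card (mem_lowerSets.1 hU).1
  omega

theorem unimodal_of_swap (h : UnimodalUpTo (lowerPoly (Function.swap r) S) S.card) :
    UnimodalUpTo (lowerPoly r S) S.card :=
  h.reverse (fun _ hj => coeff_lowerPoly_swap hj) fun _ hj => coeff_lowerPoly_eq_zero hj

theorem card_lowerSets_swap : (lowerSets (Function.swap r) S).card = (lowerSets r S).card := by
  have key : ∀ (r : α → α → Prop), ∀ U ∈ lowerSets r S, S \ U ∈ lowerSets (Function.swap r) S := by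
    intro r U hU
    rw [mem_lowerSets] at hU ⊢
    refine ⟨Finset.sdiff_subset, fun a ha b hb hba => ?_⟩
    rw [Finset.mem_sdiff] at ha ⊢
    exact ⟨hb, fun hbU => ha.2 (hU.2 b hbU a ha.1 hba)⟩
  refine Finset.card_nbij' (fun U => S \ U) (fun U => S \ U) (key _) (key _) ?_ ?_
  · intro U hU
    exact Finset.sdiff_sdiff_eq_self (mem_lowerSets.1 hU).1
  · intro U hU
    exact Finset.sdiff_sdiff_eq_self (mem_lowerSets.1 hU).1

theorem lowerPoly_of_isolated [IsPreorder α r] (hx : x ∈ S) (h : ∀ y ∈ S, ¬ Adj r x y) :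
    lowerPoly r S = lowerPoly r (S.erase x) * (1 + X) := by
  have hd : down r S x = {x} := by
    ext y
    rw [mem_down, Finset.mem_singleton]
    refine ⟨fun hy => by_contra fun hne => h y hy.1 ⟨Ne.symm hne, Or.inr hy.2⟩, ?_⟩
    rintro rfl
    exact ⟨hx, refl_of r _⟩
  have hu : up r S x = {x} := by
    ext y
    rw [mem_up, Finset.mem_singleton]
    refine ⟨fun hy => by_contra fun hne => h y hy.1 ⟨Ne.symm hne, Or.inl hy.2⟩, ?_⟩
    rintro rfl
    exact ⟨hx, refl_of r _⟩
  rw [lowerPoly_eq hx, hd, hu, Finset.card_singleton, ← Finset.erase_eq]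
  ring

theorem lowerPoly_of_isolated_set [IsPreorder α r] {A : Finset α} (hA : A ⊆ S)
    (h : ∀ x ∈ A, ∀ y ∈ S, ¬ Adj r x y) :
    lowerPoly r S = lowerPoly r (S \ A) * (1 + X) ^ A.card := by
  induction A using Finset.induction_on with
  | empty => simp
  | insert a A ha ih =>
    have haS : a ∈ S \ A := Finset.mem_sdiff.2 ⟨hA (Finset.mem_insert_self _ _), ha⟩
    rw [ih ((Finset.subset_insert _ _).trans hA)
      fun x hx => h x (Finset.mem_insert_of_mem hx), lowerPoly_of_isolated haS
      fun y hy => h a (Finset.mem_insert_self _ _) y (Finset.mem_sdiff.1 hy).1,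
      Finset.card_insert_of_notMem ha, Finset.sdiff_insert, pow_succ', mul_assoc]

theorem lowerSets_empty : lowerSets r ∅ = {∅} := by
  ext U
  rw [mem_lowerSets, Finset.mem_singleton, Finset.subset_empty]
  refine ⟨fun h => h.1, ?_⟩
  rintro rfl
  simp

theorem lowerPoly_empty : lowerPoly r ∅ = 1 := by
  simp [lowerPoly, lowerSets_empty]

/-- A star: every element is comparable to `x`. -/
theorem card_lowerSets_star_le [IsPreorder α r] {A : Finset α} (hA : ∀ y ∈ A, Adj r x y) :
    (lowerSets r (insert x A)).card ≤ 2 ^ A.card + 1 := by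
  have hxA : x ∉ A := fun h => (hA x h).1 rfl
  have hx : x ∈ insert x A := Finset.mem_insert_self _ _
  have hcard : (insert x A).card = A.card + 1 := Finset.card_insert_of_notMem hxA
  rw [card_lowerSets_eq hx]
  have hd : down r (insert x A) x ⊆ insert x A := Finset.filter_subset _ _
  have hu : up r (insert x A) x ⊆ insert x A := Finset.filter_subset _ _
  have h1 := card_lowerSets_le_two_pow (r := r) (S := insert x A \ down r (insert x A) x)
  have h2 := card_lowerSets_le_two_pow (r := r) (S := insert x A \ up r (insert x A) x)
  rw [Finset.card_sdiff_of_subset hd] at h1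
  rw [Finset.card_sdiff_of_subset hu] at h2
  have hun : down r (insert x A) x ∪ up r (insert x A) x = insert x A := by
    refine Finset.Subset.antisymm (Finset.union_subset hd hu) fun y hy => ?_
    rw [Finset.mem_union, mem_down, mem_up]
    rcases Finset.mem_insert.1 hy with rfl | hy'
    · exact Or.inl ⟨hy, refl_of r _⟩
    · exact (hA y hy').2.elim (fun h => Or.inr ⟨hy, h⟩) fun h => Or.inl ⟨hy, h⟩
  have hin : 1 ≤ (down r (insert x A) x ∩ up r (insert x A) x).card :=
    Finset.card_pos.2 ⟨x, Finset.mem_inter.2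
      ⟨mem_down.2 ⟨hx, refl_of r _⟩, mem_up.2 ⟨hx, refl_of r _⟩⟩⟩
  have hsum := Finset.card_union_add_card_inter (down r (insert x A) x) (up r (insert x A) x)
  rw [hun, hcard] at hsum
  rw [hcard] at h1 h2
  have hd' := Finset.card_le_card hd
  have hu' := Finset.card_le_card hu
  rw [hcard] at hd' hu'
  obtain ⟨p, hp⟩ : ∃ p, p = A.card + 1 - (down r (insert x A) x).card := ⟨_, rfl⟩
  obtain ⟨q, hq⟩ : ∃ q, q = A.card + 1 - (up r (insert x A) x).card := ⟨_, rfl⟩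
  rw [← hp] at h1
  rw [← hq] at h2
  -- The sets below and above `x` cover the star and share `x`, so `p + q ≤ |A|`. The bound then
  -- follows from `(2 ^ p - 1) * (2 ^ q - 1) ≥ 0`.
  have hpq : 2 ^ (p + q) ≤ 2 ^ A.card := Nat.pow_le_pow_right (by omega) (by omega)
  have hp1 : 1 ≤ 2 ^ p := Nat.one_le_two_pow
  have hq1 : 1 ≤ 2 ^ q := Nat.one_le_two_pow
  rw [pow_add] at hpq
  nlinarith

end LowerSets

/-! ### The comparability graph at density 3/8, without isolated points. -/

namespace LowerSets
open scoped Classical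

variable {α : Type*} {r : α → α → Prop} {S T : Finset α} {x : α}

/-- Heredity of the density bound: a configuration that is too sparse on a few points cannot occur
anywhere in `S`. -/
theorem three_mul_two_pow_le_of_subset (hN : 3 * 2 ^ S.card ≤ 8 * (lowerSets r S).card) (hT : T ⊆ S) :
    3 * 2 ^ T.card ≤ 8 * (lowerSets r T).card := by
  have h := card_lowerSets_le_mul (r := r) hT
  have hc := Finset.card_le_card hT
  obtain ⟨k, hk⟩ := Nat.exists_eq_add_of_le hc
  rw [hk, Nat.add_sub_cancel_left] at h
  rw [hk, pow_add] at hN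
  have hp : 0 < 2 ^ k := by positivity
  refine Nat.le_of_mul_le_mul_right ?_ hp
  calc 3 * 2 ^ T.card * 2 ^ k = 3 * (2 ^ T.card * 2 ^ k) := by ring
    _ ≤ 8 * (lowerSets r S).card := hN
    _ ≤ 8 * ((lowerSets r T).card * 2 ^ k) := Nat.mul_le_mul_left _ h
    _ = 8 * (lowerSets r T).card * 2 ^ k := by ring

section Preorder

variable [IsPreorder α r]

theorem card_lowerSets_pair_le {a b : α} (h : Adj r a b) : (lowerSets r {a, b}).card ≤ 3 := by
  have := card_lowerSets_star_le (r := r) (x := a) (A := {b}) (by simpa using h)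
  simpa using this

theorem card_lowerSets_path_le {a b c : α} (h : Adj r a b) (h' : Adj r a c) (hbc : b ≠ c) :
    (lowerSets r {a, b, c}).card ≤ 5 := by
  have := card_lowerSets_star_le (r := r) (x := a) (A := {b, c})
    (by intro y hy; rcases Finset.mem_insert.1 hy with rfl | hy
        · exact h
        · rw [Finset.mem_singleton.1 hy]; exact h')
  rw [Finset.card_pair hbc] at this
  simpa using this

/-- Few lower sets survive a path with three vertices and two edges, all disjoint. -/
theorem not_path_pair_pair (hN : 3 * 2 ^ S.card ≤ 8 * (lowerSets r S).card)
    {a b v c d e f : α} (hS : ∀ y ∈ [a, b, v, c, d, e, f], y ∈ S)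
    (hnd : [a, b, v, c, d, e, f].Nodup) (hab : Adj r a b) (hav : Adj r a v) (hcd : Adj r c d)
    (hef : Adj r e f) : False := by
  have hbv : b ≠ v := by rintro rfl; simp at hnd
  have hT : [a, b, v, c, d, e, f].toFinset ⊆ S := fun y hy => hS y (List.mem_toFinset.1 hy)
  have h := three_mul_two_pow_le_of_subset hN hT
  rw [List.toFinset_card_of_nodup hnd] at h
  have heq : [a, b, v, c, d, e, f].toFinset = {a, b, v} ∪ ({c, d} ∪ {e, f}) := by
    ext y
    simp only [List.mem_toFinset, List.mem_cons, List.not_mem_nil, or_false, Finset.mem_union,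
      Finset.mem_insert, Finset.mem_singleton, or_assoc]
  rw [heq] at h
  have h1 := card_lowerSets_union_le (r := r) (S := {a, b, v}) (T := {c, d} ∪ {e, f})
  have h2 := card_lowerSets_union_le (r := r) (S := {c, d}) (T := {e, f})
  have h3 := card_lowerSets_path_le hab hav hbv
  have h4 := Nat.mul_le_mul (card_lowerSets_pair_le hcd) (card_lowerSets_pair_le hef)
  -- At most `5 * 3 * 3 = 45` of 128 subsets, while 3/8 requires 48.
  have h5 := Nat.mul_le_mul h3 (h2.trans h4)
  simp only [List.length_cons, List.length_nil] at h
  omega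

/-- Few lower sets survive four disjoint edges. -/
theorem not_four_pairs (hN : 3 * 2 ^ S.card ≤ 8 * (lowerSets r S).card)
    {a b c d e f v w : α} (hS : ∀ y ∈ [a, b, c, d, e, f, v, w], y ∈ S)
    (hnd : [a, b, c, d, e, f, v, w].Nodup) (hab : Adj r a b) (hcd : Adj r c d)
    (hef : Adj r e f) (hvw : Adj r v w) : False := by
  have hT : [a, b, c, d, e, f, v, w].toFinset ⊆ S := fun y hy => hS y (List.mem_toFinset.1 hy)
  have h := three_mul_two_pow_le_of_subset hN hT
  rw [List.toFinset_card_of_nodup hnd] at h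
  have heq : [a, b, c, d, e, f, v, w].toFinset = ({a, b} ∪ {c, d}) ∪ ({e, f} ∪ {v, w}) := by
    ext y
    simp only [List.mem_toFinset, List.mem_cons, List.not_mem_nil, or_false, Finset.mem_union,
      Finset.mem_insert, Finset.mem_singleton, or_assoc]
  rw [heq] at h
  have h1 := card_lowerSets_union_le (r := r) (S := {a, b} ∪ {c, d}) (T := {e, f} ∪ {v, w})
  have h2 := card_lowerSets_union_le (r := r) (S := {a, b}) (T := {c, d})
  have h3 := card_lowerSets_union_le (r := r) (S := {e, f}) (T := {v, w})
  have h4 := Nat.mul_le_mul (card_lowerSets_pair_le hab) (card_lowerSets_pair_le hcd)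
  have h5 := Nat.mul_le_mul (card_lowerSets_pair_le hef) (card_lowerSets_pair_le hvw)
  -- At most `3 ^ 4 = 81` of 256 subsets, while 3/8 requires 96.
  have h6 := Nat.mul_le_mul (h2.trans h4) (h3.trans h5)
  simp only [List.length_cons, List.length_nil] at h
  omega

/-- A seventh point `v` has a neighbour `w`. If `w` lies on one of the three edges, that edge grows
into a path; otherwise `v` and `w` form a fourth disjoint edge. Both are too sparse. -/
theorem not_three_pairs (hN : 3 * 2 ^ S.card ≤ 8 * (lowerSets r S).card) (hn : 7 ≤ S.card)
    (hiso : ∀ x ∈ S, ∃ y ∈ S, Adj r x y)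
    {a b c d e f : α} (hS : ∀ y ∈ [a, b, c, d, e, f], y ∈ S)
    (hnd : [a, b, c, d, e, f].Nodup) (hab : Adj r a b) (hcd : Adj r c d)
    (hef : Adj r e f) : False := by
  obtain ⟨v, hvS, hv⟩ : ∃ v ∈ S, v ∉ [a, b, c, d, e, f].toFinset := by
    refine Finset.exists_mem_notMem_of_card_lt_card ?_
    refine lt_of_le_of_lt (List.toFinset_card_le _) ?_
    simp only [List.length_cons, List.length_nil]
    omega
  rw [List.mem_toFinset] at hv
  obtain ⟨w, hwS, hvw⟩ := hiso v hvS
  have hne := hvw.1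
  have hwv := hvw.symm
  simp only [List.mem_cons, List.not_mem_nil, or_false, forall_eq_or_imp, forall_eq] at hS
  obtain ⟨ha, hb, hc, hd, he, hf⟩ := hS
  by_cases hw : w ∈ [a, b, c, d, e, f]
  · simp only [List.mem_cons, List.not_mem_nil, or_false] at hw
    rcases hw with rfl | rfl | rfl | rfl | rfl | rfl
    · exact not_path_pair_pair hN (by simp [*]) (by simp at hnd hv ⊢; grind) hab hwv hcd hef
    · exact not_path_pair_pair hN (by simp [*]) (by simp at hnd hv ⊢; grind) hab.symm hwv hcd hef
    · exact not_path_pair_pair hN (by simp [*]) (by simp at hnd hv ⊢; grind) hcd hwv hab hef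
    · exact not_path_pair_pair hN (by simp [*]) (by simp at hnd hv ⊢; grind) hcd.symm hwv hab hef
    · exact not_path_pair_pair hN (by simp [*]) (by simp at hnd hv ⊢; grind) hef hwv hab hcd
    · exact not_path_pair_pair hN (by simp [*]) (by simp at hnd hv ⊢; grind) hef.symm hwv hab hcd
  · exact not_four_pairs hN (by simp [*]) (by simp at hnd hv hw ⊢; grind) hab hcd hef hvw

theorem exists_dominating_pair (hN : 3 * 2 ^ S.card ≤ 8 * (lowerSets r S).card)
    (hn : 7 ≤ S.card) (hiso : ∀ x ∈ S, ∃ y ∈ S, Adj r x y) :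
    ∃ a ∈ S, ∃ c ∈ S, a ≠ c ∧ ∀ v ∈ S, v ≠ a → v ≠ c → Adj r a v ∨ Adj r c v := by
  obtain ⟨a, ha⟩ : S.Nonempty := Finset.card_pos.1 (by omega)
  obtain ⟨b, hb, hab⟩ := hiso a ha
  by_cases hdis : ∃ c ∈ S, ∃ d ∈ S, Adj r c d ∧ c ≠ a ∧ c ≠ b ∧ d ≠ a ∧ d ≠ b
  swap
  -- Here every edge meets `{a, b}`, so these two points dominate.
  · refine ⟨a, ha, b, hb, hab.1, fun v hv hva hvb => ?_⟩
    obtain ⟨w, hw, hvw⟩ := hiso v hv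
    by_contra hcon
    rw [not_or] at hcon
    refine hdis ⟨v, hv, w, hw, hvw, hva, hvb, ?_, ?_⟩
    · rintro rfl; exact hcon.1 hvw.symm
    · rintro rfl; exact hcon.2 hvw.symm
  obtain ⟨c, hc, d, hd, hcd, hca, hcb, hda, hdb⟩ := hdis
  -- the vertices outside two disjoint edges attach to each edge at one end only
  have side : ∀ {a b c d : α}, a ∈ S → b ∈ S → c ∈ S → d ∈ S → Adj r a b → Adj r c d →
      c ≠ a → c ≠ b → d ≠ a → d ≠ b → ∃ a' b', (a' = a ∧ b' = b ∨ a' = b ∧ b' = a) ∧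
        ∀ v ∈ S, v ∉ [a, b, c, d] → Adj r a v ∨ Adj r b v → Adj r a' v := by
    intro a b c d ha hb hc hd hab hcd hca hcb hda hdb
    by_cases h1 : ∀ v ∈ S, v ∉ [a, b, c, d] → Adj r a v ∨ Adj r b v → Adj r a v
    · exact ⟨a, b, Or.inl ⟨rfl, rfl⟩, h1⟩
    by_cases h2 : ∀ v ∈ S, v ∉ [a, b, c, d] → Adj r a v ∨ Adj r b v → Adj r b v
    · exact ⟨b, a, Or.inr ⟨rfl, rfl⟩, h2⟩
    exfalso
    push Not at h1 h2
    obtain ⟨v, hvS, hv, hvab, hva⟩ := h1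
    obtain ⟨w, hwS, hw, hwab, hwb⟩ := h2
    have hbv : Adj r b v := hvab.resolve_left hva
    have haw : Adj r a w := hwab.resolve_right hwb
    have hvw : v ≠ w := by rintro rfl; exact hva haw
    have hab' := hab.1
    have hcd' := hcd.1
    -- Outside points attached to different ends of the edge `a b` would replace it by two disjoint
    -- edges `a w` and `b v`, giving three with `c d`.
    refine not_three_pairs hN hn hiso (a := a) (b := w) (c := b) (d := v) (e := c) (f := d)
      (by simp [*]) ?_ haw hbv hcd
    simp only [List.mem_cons, List.not_mem_nil, or_false, not_or] at hv hw
    simp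
    grind
  obtain ⟨a', b', hab', ha'⟩ := side ha hb hc hd hab hcd hca hcb hda hdb
  obtain ⟨c', d', hcd', hc'⟩ := side hc hd ha hb hcd hab hca.symm hda.symm hcb.symm hdb.symm
  refine ⟨a', by grind, c', by grind, by grind, fun v hv hva hvc => ?_⟩
  by_cases hvm : v ∈ [a, b, c, d]
  · have hba := hab.symm
    have hdc := hcd.symm
    simp only [List.mem_cons, List.not_mem_nil, or_false] at hvm
    grind
  · obtain ⟨w, hw, hvw⟩ := hiso v hv
    have hwv := hvw.symm
    have hvm' : v ∉ [c, d, a, b] := by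
      simp only [List.mem_cons, List.not_mem_nil, or_false, not_or] at hvm ⊢
      tauto
    by_cases hwm : w ∈ [a, b, c, d]
    · simp only [List.mem_cons, List.not_mem_nil, or_false] at hwm
      rcases hwm with rfl | rfl | rfl | rfl
      · exact Or.inl (ha' v hv hvm (Or.inl hwv))
      · exact Or.inl (ha' v hv hvm (Or.inr hwv))
      · exact Or.inr (hc' v hv hvm' (Or.inl hwv))
      · exact Or.inr (hc' v hv hvm' (Or.inr hwv))
    · exfalso
      have h1 := hab.1
      have h2 := hcd.1
      have h3 := hvw.1
      refine not_three_pairs hN hn hiso (a := a) (b := b) (c := c) (d := d) (e := v) (f := w)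
        (by simp [*]) ?_ hab hcd hvw
      simp only [List.mem_cons, List.not_mem_nil, or_false, not_or] at hvm hwm
      simp
      grind

/-- The stars around a dominating pair cover `S`; if both had at most three leaves, the product of
the star bounds would fall below 3/8. -/
theorem exists_large_degree (hN : 3 * 2 ^ S.card ≤ 8 * (lowerSets r S).card)
    (hn : 7 ≤ S.card) (hiso : ∀ x ∈ S, ∃ y ∈ S, Adj r x y) :
    ∃ x ∈ S, ∃ A ⊆ S, 4 ≤ A.card ∧ ∀ y ∈ A, Adj r x y := by
  obtain ⟨a, ha, c, hc, hac, hdom⟩ := exists_dominating_pair hN hn hiso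
  obtain ⟨R, hR⟩ : ∃ R, R = (S.erase a).erase c := ⟨_, rfl⟩
  have hRS : R ⊆ S := by rw [hR]; exact (Finset.erase_subset _ _).trans (Finset.erase_subset _ _)
  have hRc : R.card = S.card - 2 := by
    rw [hR, Finset.card_erase_of_mem (Finset.mem_erase.2 ⟨hac.symm, hc⟩),
      Finset.card_erase_of_mem ha]
    omega
  have hA : ∀ y ∈ R.filter (Adj r a), Adj r a y := fun y hy => (Finset.mem_filter.1 hy).2
  have hC : ∀ y ∈ R.filter (fun y => ¬ Adj r a y), Adj r c y := by
    intro y hy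
    rw [Finset.mem_filter, hR, Finset.mem_erase, Finset.mem_erase] at hy
    exact (hdom y hy.1.2.2 hy.1.2.1 hy.1.1).resolve_left hy.2
  by_contra hcon
  push Not at hcon
  have hp : (R.filter (Adj r a)).card ≤ 3 := by
    by_contra h
    obtain ⟨y, hy, hy'⟩ := hcon a ha (R.filter (Adj r a)) ((Finset.filter_subset _ _).trans hRS) (by omega)
    exact hy' (hA y hy)
  have hq : (R.filter (fun y => ¬ Adj r a y)).card ≤ 3 := by
    by_contra h
    obtain ⟨y, hy, hy'⟩ := hcon c hc (R.filter (fun y => ¬ Adj r a y)) ((Finset.filter_subset _ _).trans hRS) (by omega)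
    exact hy' (hC y hy)
  have hpq := Finset.card_filter_add_card_filter_not (s := R) (Adj r a)
  have hS : S = insert a (R.filter (Adj r a)) ∪ insert c (R.filter (fun y => ¬ Adj r a y)) := by
    ext y
    simp only [Finset.mem_union, Finset.mem_insert, Finset.mem_filter, hR, Finset.mem_erase]
    by_cases hya : y = a
    · simp [hya, ha]
    · by_cases hyc : y = c
      · simp [hyc, hc]
      · simp only [hya, hyc, ne_eq, not_false_eq_true, true_and, false_or]
        tauto
  have h1 := card_lowerSets_star_le hA
  have h2 := card_lowerSets_star_le hC
  have h3 := card_lowerSets_union_le (r := r) (S := insert a (R.filter (Adj r a)))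
    (T := insert c (R.filter (fun y => ¬ Adj r a y)))
  rw [← hS] at h3
  have h4 := h3.trans (Nat.mul_le_mul h1 h2)
  have hc' : S.card =
      (R.filter (Adj r a)).card + (R.filter (fun y => ¬ Adj r a y)).card + 2 := by omega
  rw [hc'] at hN hn
  generalize (R.filter (Adj r a)).card = p at *
  generalize (R.filter (fun y => ¬ Adj r a y)).card = q at *
  -- Since `p + q ≥ 5`, only leaf counts (3, 3) and (2, 3) in either order remain, with densities at
  -- most 81/256 and 45/128.
  interval_cases p <;> interval_cases q <;> omega

/-! ### Explicit polynomials and the case of a point with many neighbours. -/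

theorem lowerPoly_pair {y z : α} (hne : y ≠ z) (hyz : r y z) (hzy : ¬ r z y) :
    lowerPoly r {y, z} = 1 + X + X ^ 2 := by
  have hd : down r {y, z} z = {y, z} := by
    ext w
    rw [mem_down, Finset.mem_insert, Finset.mem_singleton]
    refine ⟨fun h => h.1, fun h => ⟨h, ?_⟩⟩
    rcases h with rfl | rfl
    · exact hyz
    · exact refl_of r _
  have hu : up r {y, z} z = {z} := by
    ext w
    rw [mem_up, Finset.mem_insert, Finset.mem_singleton]
    refine ⟨fun h => ?_, fun h => ⟨Or.inr h, h ▸ refl_of r _⟩⟩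
    rcases h.1 with rfl | h'
    · exact absurd h.2 hzy
    · exact h'
  have hs : ({y, z} : Finset α) \ {z} = {y} := by
    ext w
    simp only [Finset.mem_sdiff, Finset.mem_insert, Finset.mem_singleton]
    grind
  have h1 : lowerPoly r {y} = 1 + X := by
    rw [lowerPoly_of_isolated (Finset.mem_singleton_self y)]
    · simp [lowerPoly_empty]
    · intro w hw h
      exact h.1 (Finset.mem_singleton.1 hw).symm
  rw [lowerPoly_eq (Finset.mem_insert_of_mem (Finset.mem_singleton_self z)), hd, hu, hs, h1,
    Finset.sdiff_self, lowerPoly_empty, Finset.card_pair hne]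
  ring

theorem lowerPoly_of_no_adj (h : ∀ a ∈ S, ∀ b ∈ S, ¬ Adj r a b) :
    lowerPoly r S = (1 + X) ^ S.card := by
  rw [lowerPoly_of_isolated_set subset_rfl h, Finset.sdiff_self, lowerPoly_empty, one_mul]

theorem lowerPoly_of_one_adj {y z : α} (hne : y ≠ z) (hyz : r y z) (hzy : ¬ r z y)
    (hsub : {y, z} ⊆ S)
    (h : ∀ a ∈ S, ∀ b ∈ S, Adj r a b → a ∈ ({y, z} : Finset α)) :
    lowerPoly r S = (1 + X + X ^ 2) * (1 + X) ^ (S.card - 2) := by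
  rw [lowerPoly_of_isolated_set (A := S \ {y, z}) Finset.sdiff_subset
    (fun a ha b hb hab => (Finset.mem_sdiff.1 ha).2 (h a (Finset.mem_sdiff.1 ha).1 b hb hab)),
    Finset.sdiff_sdiff_eq_self hsub, lowerPoly_pair hne hyz hzy, Finset.card_sdiff_of_subset hsub,
    Finset.card_pair hne]

/-- With more than five eighths of all subsets, there is at most one comparability. -/
theorem at_most_one_adj (hN : 5 * 2 ^ S.card < 8 * (lowerSets r S).card) :
    (∀ a ∈ S, ∀ b ∈ S, ¬ Adj r a b) ∨
      ∃ y z, y ≠ z ∧ r y z ∧ ¬ r z y ∧ {y, z} ⊆ S ∧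
        ∀ a ∈ S, ∀ b ∈ S, Adj r a b → a ∈ ({y, z} : Finset α) ∧ b ∈ ({y, z} : Finset α) := by
  have key : ∀ T ⊆ S, 5 * 2 ^ T.card < 8 * (lowerSets r T).card := by
    intro T hT
    have h := card_lowerSets_le_mul (r := r) hT
    obtain ⟨k, hk⟩ := Nat.exists_eq_add_of_le (Finset.card_le_card hT)
    rw [hk, Nat.add_sub_cancel_left] at h
    rw [hk, pow_add] at hN
    refine Nat.lt_of_mul_lt_mul_right (a := 2 ^ k) ?_
    calc 5 * 2 ^ T.card * 2 ^ k = 5 * (2 ^ T.card * 2 ^ k) := by ring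
      _ < 8 * (lowerSets r S).card := hN
      _ ≤ 8 * ((lowerSets r T).card * 2 ^ k) := Nat.mul_le_mul_left _ h
      _ = 8 * (lowerSets r T).card * 2 ^ k := by ring
  have path : ∀ a ∈ S, ∀ b ∈ S, ∀ c ∈ S, Adj r a b → Adj r a c → b = c := by
    intro a ha b hb c hc hab hac
    by_contra hbc
    have h1 := key {a, b, c} (by intro y; simp; rintro (rfl | rfl | rfl) <;> assumption)
    have h2 := card_lowerSets_path_le hab hac hbc
    rw [Finset.card_eq_three.2 ⟨a, b, c, hab.1, hac.1, hbc, rfl⟩] at h1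
    omega
  by_cases hex : ∃ a ∈ S, ∃ b ∈ S, Adj r a b
  swap
  · left
    push Not at hex
    exact hex
  right
  obtain ⟨a, ha, b, hb, hab⟩ := hex
  have hsubab : {a, b} ⊆ S := by intro y; simp; rintro (rfl | rfl) <;> assumption
  have only : ∀ c ∈ S, ∀ d ∈ S, Adj r c d → c ∈ ({a, b} : Finset α) ∧ d ∈ ({a, b} : Finset α) := by
    intro c hc d hd hcd
    simp only [Finset.mem_insert, Finset.mem_singleton]
    by_cases hca : c = a
    · subst hca
      exact ⟨Or.inl rfl, Or.inr (path c hc d hd b hb hcd hab)⟩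
    by_cases hcb : c = b
    · subst hcb
      exact ⟨Or.inr rfl, Or.inl (path c hc d hd a ha hcd hab.symm)⟩
    by_cases hda : d = a
    · subst hda
      exact absurd (path d hd c hc b hb hcd.symm hab) hcb
    by_cases hdb : d = b
    · subst hdb
      exact absurd (path d hd c hc a ha hcd.symm hab.symm) hca
    exfalso
    have h1 := key ({a, b} ∪ {c, d}) (Finset.union_subset hsubab
      (by intro y; simp; rintro (rfl | rfl) <;> assumption))
    have h2 := card_lowerSets_union_le (r := r) (S := {a, b}) (T := {c, d})
    -- Two disjoint edges have density at most 9/16, below 5/8.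
    have h3 := Nat.mul_le_mul (card_lowerSets_pair_le hab) (card_lowerSets_pair_le hcd)
    rw [Finset.card_union_of_disjoint, Finset.card_pair hab.1, Finset.card_pair hcd.1] at h1
    · omega
    · rw [Finset.disjoint_left]
      simp only [Finset.mem_insert, Finset.mem_singleton]
      grind
  -- Two equivalent points have only two lower sets, density 1/2.
  have hnot : ¬ (r a b ∧ r b a) := by
    rintro ⟨h1, h2⟩
    have h3 := key {a, b} hsubab
    have hm : a ∈ ({a, b} : Finset α) := Finset.mem_insert_self _ _
    have hd : down r {a, b} a = {a, b} := by
      refine Finset.filter_true_of_mem ?_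
      simp only [Finset.mem_insert, Finset.mem_singleton]
      rintro y (rfl | rfl)
      exacts [refl_of r _, h2]
    have hu : up r {a, b} a = {a, b} := by
      refine Finset.filter_true_of_mem ?_
      simp only [Finset.mem_insert, Finset.mem_singleton]
      rintro y (rfl | rfl)
      exacts [refl_of r _, h1]
    have h4 := card_lowerSets_le_two_pow (r := r) (S := ∅)
    rw [card_lowerSets_eq hm, hd, hu, Finset.sdiff_self, Finset.card_pair hab.1] at h3
    simp only [Finset.card_empty] at h4
    omega
  rcases hab.2 with h | h
  · exact ⟨a, b, hab.1, h, fun h' => hnot ⟨h, h'⟩, hsubab, only⟩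
  · refine ⟨b, a, hab.1.symm, h, fun h' => hnot ⟨h', h⟩, ?_, ?_⟩
    · rwa [Finset.pair_comm]
    · rwa [Finset.pair_comm b a]

/-- Unimodality when one minimal element lies below all but one of the comparabilities. -/
theorem unimodal_of_minimal (hN : 3 * 2 ^ S.card ≤ 8 * (lowerSets r S).card) (hx : x ∈ S)
    (hd : (down r S x).card = 1) (hu : 5 ≤ (up r S x).card) :
    UnimodalUpTo (lowerPoly r S) S.card := by
  have hds : down r S x ⊆ S := Finset.filter_subset _ _
  have hus : up r S x ⊆ S := Finset.filter_subset _ _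
  have hY := Finset.card_sdiff_of_subset hds
  have hZ := Finset.card_sdiff_of_subset hus
  have huc := Finset.card_le_card hus
  have hZY : S \ up r S x ⊆ S \ down r S x := by
    have hdx : down r S x ⊆ {x} := by
      obtain ⟨w, hw⟩ := Finset.card_eq_one.1 hd
      have hxd : x ∈ down r S x := mem_down.2 ⟨hx, refl_of r _⟩
      rw [hw, Finset.mem_singleton] at hxd
      rw [hw, hxd]
    refine Finset.sdiff_subset_sdiff subset_rfl (hdx.trans ?_)
    exact Finset.singleton_subset_iff.2 (mem_up.2 ⟨hx, refl_of r _⟩)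
  have hpoly := lowerPoly_eq (r := r) hx
  have hcount := card_lowerSets_eq (r := r) hx
  have hZle := card_lowerSets_le_two_pow (r := r) (S := S \ up r S x)
  rw [hd, pow_one] at hpoly
  obtain ⟨u, hu'⟩ := Nat.exists_eq_add_of_le hu
  obtain ⟨m, hm⟩ : ∃ m, S.card = 5 + u + m := ⟨S.card - (5 + u), by omega⟩
  have hYc : (S \ down r S x).card = 4 + u + m := by omega
  have hZc : (S \ up r S x).card = m := by omega
  -- Lower sets avoiding `x` number at most 1/32 of all subsets of `S`. The others number at least
  -- 3/8 - 1/32 = 11/32 of them, which is density 11/16 on the remaining points.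
  have hYN : 5 * 2 ^ (S \ down r S x).card < 8 * (lowerSets r (S \ down r S x)).card := by
    rw [hYc]
    rw [hZc] at hZle
    rw [hm, hcount] at hN
    have h1 : 2 ^ (5 + u + m) = 2 * 2 ^ (4 + u + m) := by ring
    have h2 : 2 ^ (4 + u + m) = 16 * (2 ^ u * 2 ^ m) := by ring
    have h3 : 2 ^ m ≤ 2 ^ u * 2 ^ m := Nat.le_mul_of_pos_left _ (by positivity)
    have h4 : 0 < 2 ^ m := by positivity
    omega
  rw [hpoly, hm]
  rcases at_most_one_adj hYN with hno | ⟨y, z, hne, hyz, hzy, hsub, honly⟩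
  · rw [lowerPoly_of_no_adj hno,
      lowerPoly_of_no_adj fun a ha b hb => hno a (hZY ha) b (hZY hb), hYc, hZc]
    have h := ((UnimodalUpTo.one.mul_one_add_X_pow (4 + u)).X_mul_add_one).mul_one_add_X_pow m
    convert h using 1
    · ring
    · omega
  · rw [lowerPoly_of_one_adj hne hyz hzy hsub fun a ha b hb hab => (honly a ha b hb hab).1, hYc]
    -- Whether the one comparability survives outside `up r S x` decides if `1 + X + X ^ 2` is a
    -- common factor of the second summand.
    by_cases hsubZ : {y, z} ⊆ S \ up r S x
    · rw [lowerPoly_of_one_adj hne hyz hzy hsubZ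
        fun a ha b hb hab => (honly a (hZY ha) b (hZY hb) hab).1, hZc]
      have hm2 := Finset.card_le_card hsubZ
      rw [Finset.card_pair hne, hZc] at hm2
      obtain ⟨k, rfl⟩ := Nat.exists_eq_add_of_le hm2
      have hq := UnimodalUpTo.one_add_X_add_sq.mul_one_add_X_pow (4 + u)
      have h := (hq.X_mul_add_one_add_X_add_sq (by omega) ?_).mul_one_add_X_pow k
      · convert h using 1
        · rw [show 4 + u + (2 + k) - 2 = 4 + u + k by omega, show 2 + k - 2 = k by omega]
          ring
        · omega
      · have e : ((1 + X + X ^ 2) * (1 + X) ^ (4 + u) : ℕ[X]) =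
            (1 + X) ^ (4 + u) + X * (1 + X) ^ (4 + u) + X * (X * (1 + X) ^ (4 + u)) := by ring
        have h1 : ((1 + X + X ^ 2) * (1 + X) ^ (4 + u) : ℕ[X]).coeff 1 = 4 + u + 1 := by
          rw [e]
          simp [coeff_X_mul, coeff_one_add_X_pow]
        have h2 : ((1 + X + X ^ 2) * (1 + X) ^ (4 + u) : ℕ[X]).coeff 2 =
            (4 + u).choose 2 + (4 + u) + 1 := by
          rw [e]
          simp [coeff_X_mul, coeff_one_add_X_pow]
        have h3 : 0 < (4 + u).choose 2 := Nat.choose_pos (by omega)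
        omega
    · have hnoZ : ∀ a ∈ S \ up r S x, ∀ b ∈ S \ up r S x, ¬ Adj r a b := by
        intro a ha b hb hab
        apply hsubZ
        have h := honly a (hZY ha) b (hZY hb) hab
        have hab' := hab.1
        intro w hw
        simp only [Finset.mem_insert, Finset.mem_singleton] at h hw
        grind
      rw [lowerPoly_of_no_adj hnoZ, hZc]
      have h := ((UnimodalUpTo.one_add_X_add_sq.mul_one_add_X_pow
        (2 + u)).X_mul_add_one).mul_one_add_X_pow m
      convert h using 1
      · rw [show 4 + u + m - 2 = 2 + u + m by omega]
        ring
      · omega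

theorem unimodal_of_no_isolated (hN : 3 * 2 ^ S.card ≤ 8 * (lowerSets r S).card)
    (hn : 7 ≤ S.card) (hiso : ∀ x ∈ S, ∃ y ∈ S, Adj r x y) :
    UnimodalUpTo (lowerPoly r S) S.card := by
  obtain ⟨x, hx, A, hAS, hA4, hA⟩ := exists_large_degree hN hn hiso
  have hds : down r S x ⊆ S := Finset.filter_subset _ _
  have hus : up r S x ⊆ S := Finset.filter_subset _ _
  have hxd : x ∈ down r S x := mem_down.2 ⟨hx, refl_of r _⟩
  have hxu : x ∈ up r S x := mem_up.2 ⟨hx, refl_of r _⟩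
  have hun : insert x A ⊆ down r S x ∪ up r S x := by
    intro y hy
    rw [Finset.mem_union]
    rcases Finset.mem_insert.1 hy with rfl | hy
    · exact Or.inl hxd
    · exact (hA y hy).2.elim (fun h => Or.inr (mem_up.2 ⟨hAS hy, h⟩))
        fun h => Or.inl (mem_down.2 ⟨hAS hy, h⟩)
  have h1 := Finset.card_le_card hun
  rw [Finset.card_insert_of_notMem fun h => (hA x h).1 rfl] at h1
  have h2 := Finset.card_union_add_card_inter (down r S x) (up r S x)
  have h3 : 0 < (down r S x ∩ up r S x).card :=
    Finset.card_pos.2 ⟨x, Finset.mem_inter.2 ⟨hxd, hxu⟩⟩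
  have hd0 : 0 < (down r S x).card := Finset.card_pos.2 ⟨x, hxd⟩
  have hu0 : 0 < (up r S x).card := Finset.card_pos.2 ⟨x, hxu⟩
  rcases Nat.lt_or_ge (down r S x).card 2 with hd | hd
  · exact unimodal_of_minimal hN hx (by omega) (by omega)
  rcases Nat.lt_or_ge (up r S x).card 2 with hu | hu
  · refine unimodal_of_swap (unimodal_of_minimal (x := x) ?_ hx ?_ ?_)
    · rwa [card_lowerSets_swap]
    · change (up r S x).card = 1
      omega
    · change 5 ≤ (down r S x).card
      omega
  -- If both sets have at least two elements, their sizes sum to at least 6. The density is then at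
  -- most 1/4 + 1/16 or 1/8 + 1/8, below 3/8.
  exfalso
  have hdc := Finset.card_le_card hds
  have huc := Finset.card_le_card hus
  have hcount := card_lowerSets_eq (r := r) hx
  have h4 := card_lowerSets_le_two_pow (r := r) (S := S \ down r S x)
  have h5 := card_lowerSets_le_two_pow (r := r) (S := S \ up r S x)
  rw [Finset.card_sdiff_of_subset hds] at h4
  rw [Finset.card_sdiff_of_subset hus] at h5
  obtain ⟨m, hm⟩ : ∃ m, S.card = m + 4 := ⟨S.card - 4, by omega⟩
  rw [hm] at hN h4 h5
  have bound : ∀ {i j : ℕ}, j ≤ i → 2 ^ (m + 4 - i) ≤ 2 ^ (m + 4 - j) :=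
    fun h => Nat.pow_le_pow_right (by omega) (by omega)
  have e2 : 2 ^ (m + 4 - 2) = 4 * 2 ^ m := by rw [show m + 4 - 2 = m + 2 by omega]; ring
  have e3 : 2 ^ (m + 4 - 3) = 2 * 2 ^ m := by rw [show m + 4 - 3 = m + 1 by omega]; ring
  have e4 : 2 ^ (m + 4 - 4) = 2 ^ m := by rw [show m + 4 - 4 = m by omega]
  have e0 : 2 ^ (m + 4) = 16 * 2 ^ m := by ring
  have hm0 : 0 < 2 ^ m := by positivity
  rcases Nat.lt_or_ge (down r S x).card 4 with hd4 | hd4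
  · rcases Nat.lt_or_ge (up r S x).card 4 with hu4 | hu4
    · have := bound (show 3 ≤ (down r S x).card by omega)
      have := bound (show 3 ≤ (up r S x).card by omega)
      omega
    · have := bound hd
      have := bound hu4
      omega
  · have := bound hd4
    have := bound hu
    omega

end Preorder

end LowerSets

/-! ### Enumeration of the small cases by Boolean vectors. -/

namespace BitVectors

/-! The functions that are evaluated by the kernel are written with recursors, which reduce faster
than compiled structural recursion. -/

/-- Coordinatewise comparison of Boolean vectors. -/
noncomputable def le (v : List Bool) : List Bool → Bool :=
  List.rec (fun _ => true)
    (fun a _ ih w => List.rec false (fun b w _ => Bool.rec (ih w) (Bool.rec false (ih w) b) a) w) v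

/-- The vectors in `L` above `d`, each with a true entry put in front. -/
noncomputable def consAbove (d : List Bool) (L : List (List Bool)) : List (List Bool) :=
  List.rec [] (fun v _ ih => Bool.rec ih ((true :: v) :: ih) (le d v)) L

/-- The indicator vectors of the lower sets, after a maximal point with lower bounds `d` is
added. -/
noncomputable def extend (L : List (List Bool)) (d : List Bool) : List (List Bool) :=
  List.rec (consAbove d L) (fun v _ ih => (false :: v) :: ih) L

/-- The indicator vectors of the lower sets, after a twin of the `i`-th point is added. -/
def duplicate (L : List (List Bool)) (i : ℕ) : List (List Bool) :=
  L.map fun v => v.getD i false :: v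

/-- The length of a list. -/
noncomputable def len (L : List (List Bool)) : ℕ := List.rec 0 (fun _ _ ih => Nat.succ ih) L

/-- All families of lower sets of preorders on `k` listed points, as indicator vectors, that have
at least three eighths of all subsets at each stage of the construction. -/
noncomputable def families : ℕ → List (List (List Bool))
  | 0 => [[[]]]
  | k + 1 => ((families k).flatMap fun L =>
      L.map (extend L) ++ (List.range k).map (duplicate L)).filter
        fun L => Nat.ble (Nat.mul 3 (Nat.pow 2 (k + 1))) (Nat.mul 8 (len L))

/-- The number of true entries. -/
noncomputable def weight (v : List Bool) : ℕ :=
  List.rec 0 (fun b _ ih => Bool.rec ih (Nat.succ ih) b) v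

/-- The number of vectors in `L` with exactly `j` true entries. -/
noncomputable def countWeight (L : List (List Bool)) (j : ℕ) : ℕ :=
  List.rec 0 (fun v _ ih => Bool.rec ih (Nat.succ ih) (Nat.beq (weight v) j)) L

/-- Weakly decreasing lists. -/
def isDecreasing : List ℕ → Bool
  | [] => true
  | [_] => true
  | a :: b :: l => Nat.ble b a && isDecreasing (b :: l)

/-- Lists that weakly increase and then weakly decrease. -/
def isUnimodal : List ℕ → Bool
  | [] => true
  | [_] => true
  | a :: b :: l => bif Nat.ble a b then isUnimodal (b :: l) else isDecreasing (a :: b :: l)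

/-- The numbers of vectors in `L` of weight `0, …, n`. -/
noncomputable def weights (n : ℕ) (L : List (List Bool)) : List ℕ := (List.range (n + 1)).map (countWeight L)

/-- The weight distribution of `L` up to weight `n` is positive and unimodal. -/
noncomputable def isPositiveUnimodal (n : ℕ) (L : List (List Bool)) : Bool :=
  (weights n L).all (Nat.blt 0) && isUnimodal (weights n L)

theorem families_five : (families 5).all (isPositiveUnimodal 5) = true := by decide +kernel

theorem families_six : (families 6).all (isPositiveUnimodal 6) = true := by decide +kernel

theorem le_cons_cons (a b : Bool) (v w : List Bool) :
    le (a :: v) (b :: w) = ((!a || b) && le v w) := by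
  cases a <;> cases b <;> rfl

theorem consAbove_eq (d : List Bool) (L : List (List Bool)) :
    consAbove d L = (L.filter (le d)).map (true :: ·) := by
  induction L with
  | nil => rfl
  | cons v L ih =>
    change (Bool.rec (consAbove d L) ((true :: v) :: consAbove d L) (le d v) : List (List Bool)) = _
    rw [ih, List.filter_cons]
    cases le d v <;> rfl

theorem extend_eq (L : List (List Bool)) (d : List Bool) :
    extend L d = L.map (false :: ·) ++ (L.filter (le d)).map (true :: ·) := by
  rw [← consAbove_eq, extend]
  generalize consAbove d L = K
  induction L with
  | nil => rfl
  | cons v L ih => exact congrArg ((false :: v) :: ·) ih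

theorem len_eq (L : List (List Bool)) : len L = L.length := by
  induction L with
  | nil => rfl
  | cons v L ih => exact congrArg Nat.succ ih

theorem weight_eq (v : List Bool) : weight v = v.count true := by
  induction v with
  | nil => rfl
  | cons b v ih =>
    change (Bool.rec (weight v) (Nat.succ (weight v)) b : ℕ) = _
    rw [ih]
    cases b <;> simp

theorem countWeight_eq (L : List (List Bool)) (j : ℕ) :
    countWeight L j = L.countP fun v => decide (v.count true = j) := by
  induction L with
  | nil => rfl
  | cons v L ih =>
    change (Bool.rec (countWeight L j) (Nat.succ (countWeight L j)) (Nat.beq (weight v) j) : ℕ) = _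
    rw [ih, weight_eq, List.countP_cons]
    by_cases h : v.count true = j
    · rw [show Nat.beq (v.count true) j = true by rwa [Nat.beq_eq]]
      simp [h]
    · rw [Bool.eq_false_iff.2 fun h' => h (Nat.eq_of_beq_eq_true h')]
      simp [h]

theorem getD_succ_le_of_isDecreasing {l : List ℕ} (h : isDecreasing l = true) (j : ℕ) :
    l.getD (j + 1) 0 ≤ l.getD j 0 := by
  induction l generalizing j with
  | nil => simp
  | cons a l ih =>
    cases l with
    | nil => simp
    | cons b l =>
      simp only [isDecreasing, Bool.and_eq_true, Nat.ble_eq] at h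
      cases j with
      | zero => simpa using h.1
      | succ j => simpa using ih h.2 j

theorem exists_mode_of_isUnimodal {l : List ℕ} (h : isUnimodal l = true) :
    ∃ k, (∀ j < k, l.getD j 0 ≤ l.getD (j + 1) 0) ∧
      ∀ j, k ≤ j → l.getD (j + 1) 0 ≤ l.getD j 0 := by
  induction l with
  | nil => exact ⟨0, by simp, by simp⟩
  | cons a l ih =>
    cases l with
    | nil => exact ⟨0, by simp, by simp⟩
    | cons b l =>
      by_cases hab : Nat.ble a b = true
      · rw [isUnimodal, hab, cond_true] at h
        obtain ⟨k, hup, hdown⟩ := ih h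
        rw [Nat.ble_eq] at hab
        refine ⟨k + 1, ?_, ?_⟩
        · rintro (_ | j) hj
          · simpa using hab
          · simpa using hup j (by omega)
        · rintro (_ | j) hj
          · omega
          · simpa using hdown j (by omega)
      · rw [Bool.not_eq_true] at hab
        rw [isUnimodal, hab, cond_false] at h
        exact ⟨0, by simp, fun j _ => getD_succ_le_of_isDecreasing h j⟩

end BitVectors

/-! ### Completeness of the enumeration, and the induction on points. -/

namespace LowerSets
open scoped Classical
open BitVectors

variable {α : Type*} {r : α → α → Prop}

/-- The indicator vector of `U` along the list `l`. -/
noncomputable def indicator (l : List α) (U : Finset α) : List Bool := l.map fun a => decide (a ∈ U)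

theorem le_indicator {l : List α} {D U : Finset α} :
    le (indicator l D) (indicator l U) = true ↔ ∀ a ∈ l, a ∈ D → a ∈ U := by
  induction l with
  | nil => exact ⟨fun _ _ h => absurd h List.not_mem_nil, fun _ => rfl⟩
  | cons a l ih =>
    simp only [indicator, List.map_cons, le_cons_cons, Bool.and_eq_true, List.mem_cons, forall_eq_or_imp]
    refine and_congr ?_ ih
    by_cases h : a ∈ D <;> simp [h]

theorem count_indicator {l : List α} (hl : l.Nodup) {U : Finset α} (hU : U ⊆ l.toFinset) :
    (indicator l U).count true = U.card := by
  have h : (l.filter fun a => decide (a ∈ U)).toFinset = U := by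
    ext a
    simp only [List.mem_toFinset, List.mem_filter, decide_eq_true_eq]
    exact ⟨fun h => h.2, fun h => ⟨List.mem_toFinset.1 (hU h), h⟩⟩
  rw [indicator, List.count_eq_countP, List.countP_map, List.countP_eq_length_filter,
    ← List.toFinset_card_of_nodup (hl.filter _)]
  congr 1
  rw [← h]
  congr 1
  refine List.filter_congr fun a _ => ?_
  by_cases ha : a ∈ U <;> simp [ha, h]

theorem indicator_cons {l : List α} {a : α} {U : Finset α} :
    indicator (a :: l) U = decide (a ∈ U) :: indicator l U := rfl

theorem indicator_insert {l : List α} {a : α} (ha : a ∉ l) {U : Finset α} :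
    indicator l (insert a U) = indicator l U := by
  refine List.map_congr_left fun b hb => ?_
  have : b ≠ a := by rintro rfl; exact ha hb
  simp [this]

/-- `L` lists the indicator vectors along `l` of the lower sets of the points in `l`. -/
def Lists (r : α → α → Prop) (l : List α) (L : List (List Bool)) : Prop :=
  (L : Multiset (List Bool)) = (lowerSets r l.toFinset).val.map (indicator l)

theorem Lists.length_eq {l : List α} {L : List (List Bool)} (h : Lists r l L) :
    L.length = (lowerSets r l.toFinset).card := by
  have := congrArg Multiset.card h
  simpa using this

theorem Lists.countWeight_eq {l : List α} {L : List (List Bool)} (hl : l.Nodup)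
    (h : Lists r l L) (j : ℕ) : countWeight L j = (lowerPoly r l.toFinset).coeff j := by
  have hc : countWeight L j =
      Multiset.countP (fun v : List Bool => v.count true = j) (L : Multiset (List Bool)) := by
    rw [Multiset.coe_countP, BitVectors.countWeight_eq]
  rw [coeff_lowerPoly, hc, h, Multiset.countP_map, Finset.card, Finset.filter_val]
  refine congrArg _ (Multiset.filter_congr fun U hU => ?_)
  rw [count_indicator hl (mem_lowerSets.1 hU).1]

/-- As no earlier point lies above `a`, the old lower sets stay lower sets, and `a` can be added
exactly to those containing its lower bounds. These lower bounds form a lower set, so `d` can be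
sought in `L` itself. -/
theorem Lists.extend [IsPreorder α r] {l : List α} {L : List (List Bool)} {a : α}
    (h : Lists r l L) (ha : a ∉ l) (hmax : ∀ b ∈ l, ¬ r a b) :
    ∃ d ∈ L, Lists r (a :: l) (BitVectors.extend L d) := by
  have haS : a ∉ l.toFinset := by simpa using ha
  have hD : down r l.toFinset a ∈ lowerSets r l.toFinset := by
    refine mem_lowerSets.2 ⟨Finset.filter_subset _ _, fun b hb c hc hcb => ?_⟩
    exact mem_down.2 ⟨hc, trans_of r hcb (mem_down.1 hb).2⟩
  refine ⟨indicator l (down r l.toFinset a), ?_, ?_⟩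
  · rw [← Multiset.mem_coe, h]
    exact Multiset.mem_map_of_mem _ hD
  have hdec : lowerSets r (a :: l).toFinset = lowerSets r l.toFinset ∪
      ((lowerSets r l.toFinset).filter fun U => down r l.toFinset a ⊆ U).image (insert a) := by
    ext U
    rw [List.toFinset_cons, Finset.mem_union, Finset.mem_image]
    constructor
    · intro hU
      rw [mem_lowerSets] at hU
      by_cases haU : a ∈ U
      · right
        refine ⟨U.erase a, ?_, Finset.insert_erase haU⟩
        rw [Finset.mem_filter, mem_lowerSets]
        refine ⟨⟨?_, fun b hb c hc hcb => ?_⟩, fun c hc => ?_⟩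
        · exact Finset.subset_insert_iff.1 hU.1
        · refine Finset.mem_erase.2 ⟨?_, ?_⟩
          · rintro rfl; exact haS hc
          · exact hU.2 b (Finset.mem_erase.1 hb).2 c (Finset.mem_insert_of_mem hc) hcb
        · rw [mem_down] at hc
          refine Finset.mem_erase.2 ⟨?_, ?_⟩
          · rintro rfl; exact haS hc.1
          · exact hU.2 a haU c (Finset.mem_insert_of_mem hc.1) hc.2
      · left
        rw [mem_lowerSets]
        refine ⟨fun b hb => ?_, fun b hb c hc => hU.2 b hb c (Finset.mem_insert_of_mem hc)⟩
        refine (Finset.mem_insert.1 (hU.1 hb)).resolve_left ?_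
        rintro rfl; exact haU hb
    · rintro (hU | ⟨V, hV, rfl⟩)
      · rw [mem_lowerSets] at hU ⊢
        refine ⟨hU.1.trans (Finset.subset_insert _ _), fun b hb c hc hcb => ?_⟩
        rcases Finset.mem_insert.1 hc with rfl | hc
        · exact absurd hcb (hmax b (List.mem_toFinset.1 (hU.1 hb)))
        · exact hU.2 b hb c hc hcb
      · rw [Finset.mem_filter, mem_lowerSets] at hV
        rw [mem_lowerSets]
        refine ⟨Finset.insert_subset_insert _ hV.1.1, fun b hb c hc hcb => ?_⟩
        rcases Finset.mem_insert.1 hc with rfl | hcl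
        · exact Finset.mem_insert_self _ _
        · refine Finset.mem_insert_of_mem ?_
          rcases Finset.mem_insert.1 hb with rfl | hbV
          · exact hV.2 (mem_down.2 ⟨hcl, hcb⟩)
          · exact hV.1.2 b hbV c hcl hcb
  have hnot : ∀ U ∈ lowerSets r l.toFinset, a ∉ U :=
    fun U hU haU => haS ((mem_lowerSets.1 hU).1 haU)
  have hdisj : Disjoint (lowerSets r l.toFinset)
      (((lowerSets r l.toFinset).filter fun U => down r l.toFinset a ⊆ U).image (insert a)) := by
    rw [Finset.disjoint_left]
    intro U hU hU'
    obtain ⟨V, _, rfl⟩ := Finset.mem_image.1 hU'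
    exact hnot _ hU (Finset.mem_insert_self _ _)
  have hinj : Set.InjOn (insert a)
      (((lowerSets r l.toFinset).filter fun U => down r l.toFinset a ⊆ U) :
        Set (Finset α)) := by
    intro U hU V hV hUV
    have hU' := hnot U (Finset.mem_filter.1 hU).1
    have hV' := hnot V (Finset.mem_filter.1 hV).1
    rw [← Finset.erase_insert hU', ← Finset.erase_insert hV', hUV]
  have hfilter : (L.filter (le (indicator l (down r l.toFinset a))) : Multiset (List Bool)) =
      Multiset.filter (fun v => le (indicator l (down r l.toFinset a)) v = true) L := by
    rw [Multiset.filter_coe]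
    exact congrArg _ (List.filter_congr fun v _ => by simp)
  unfold Lists
  rw [hdec, ← Finset.disjUnion_eq_union _ _ hdisj, Finset.disjUnion, Multiset.map_add,
    Finset.image_val_of_injOn hinj, Multiset.map_map, extend_eq, ← Multiset.coe_add,
    ← Multiset.map_coe, ← Multiset.map_coe, hfilter, h, Multiset.map_map,
    Multiset.filter_map, Multiset.map_map, Finset.filter_val]
  congr 1
  · refine Multiset.map_congr rfl fun U hU => ?_
    simp [indicator_cons, hnot U hU]
  · have hf : Multiset.filter ((fun v => le (indicator l (down r l.toFinset a)) v = true) ∘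
        indicator l) (lowerSets r l.toFinset).val =
        Multiset.filter (fun U => down r l.toFinset a ⊆ U) (lowerSets r l.toFinset).val := by
      refine Multiset.filter_congr fun U _ => ?_
      rw [Function.comp_apply, le_indicator]
      exact ⟨fun h b hb => h b (List.mem_toFinset.1 (mem_down.1 hb).1) hb, fun h b _ hb => h hb⟩
    rw [hf]
    refine Multiset.map_congr rfl fun U _ => ?_
    simp [indicator_cons, indicator_insert ha]

/-- A lower set contains `a` exactly when it contains the equivalent point `b`, so the new
coordinate copies that of `b`. -/
theorem Lists.duplicate [IsPreorder α r] {l : List α} {L : List (List Bool)} {a b : α}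
    (h : Lists r l L) (ha : a ∉ l) (hb : b ∈ l) (hab : r a b) (hba : r b a) :
    ∃ i < l.length, Lists r (a :: l) (BitVectors.duplicate L i) := by
  obtain ⟨i, hi, rfl⟩ := List.mem_iff_getElem.1 hb
  refine ⟨i, hi, ?_⟩
  have haS : a ∉ l.toFinset := by simpa using ha
  have hbS : l[i] ∈ l.toFinset := by simp
  have hne : l[i] ≠ a := fun h => ha (h ▸ hb)
  have hnot : ∀ U ∈ lowerSets r l.toFinset, a ∉ U :=
    fun U hU haU => haS ((mem_lowerSets.1 hU).1 haU)
  obtain ⟨g, hg⟩ : ∃ g : Finset α → Finset α, g = fun U => if l[i] ∈ U then insert a U else U :=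
    ⟨_, rfl⟩
  have herase : ∀ U ∈ lowerSets r l.toFinset, (g U).erase a = U := by
    intro U hU
    rw [hg]
    dsimp only
    split_ifs
    · exact Finset.erase_insert (hnot U hU)
    · exact Finset.erase_eq_of_notMem (hnot U hU)
  have hmem : ∀ U, ∀ c, c ≠ a → (c ∈ g U ↔ c ∈ U) := by
    intro U c hc
    rw [hg]
    dsimp only
    split_ifs
    · rw [Finset.mem_insert]; tauto
    · rfl
  have hmema : ∀ U ∈ lowerSets r l.toFinset, (a ∈ g U ↔ l[i] ∈ U) := by
    intro U hU
    rw [hg]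
    dsimp only
    split_ifs with h'
    · simp [h']
    · simp [h', hnot U hU]
  have hinj : Set.InjOn g (lowerSets r l.toFinset : Set (Finset α)) := by
    intro U hU V hV hUV
    rw [← herase U hU, ← herase V hV, hUV]
  have hdec : lowerSets r (a :: l).toFinset = (lowerSets r l.toFinset).image g := by
    ext U
    rw [List.toFinset_cons, Finset.mem_image]
    constructor
    · intro hU
      have hV : U ∩ l.toFinset ∈ lowerSets r l.toFinset :=
        inter_mem_lowerSets hU (Finset.subset_insert _ _)
      refine ⟨_, hV, ?_⟩
      rw [mem_lowerSets] at hU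
      ext c
      by_cases hca : c = a
      · subst hca
        rw [hmema _ hV, Finset.mem_inter]
        constructor
        · rintro ⟨h1, _⟩
          exact hU.2 _ h1 c (Finset.mem_insert_self _ _) hab
        · intro h1
          exact ⟨hU.2 _ h1 _ (Finset.mem_insert_of_mem hbS) hba, hbS⟩
      · rw [hmem _ c hca, Finset.mem_inter]
        exact ⟨fun h => h.1, fun h => ⟨h, (Finset.mem_insert.1 (hU.1 h)).resolve_left hca⟩⟩
    · rintro ⟨V, hV, rfl⟩
      have hV' := mem_lowerSets.1 hV
      have hin : ∀ c ∈ g V, ∀ d ∈ l.toFinset, r d c → d ∈ V := by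
        intro c hc d hd hdc
        by_cases hca : c = a
        · subst hca
          exact hV'.2 _ ((hmema V hV).1 hc) d hd (trans_of r hdc hab)
        · exact hV'.2 c ((hmem V c hca).1 hc) d hd hdc
      rw [mem_lowerSets]
      refine ⟨fun c hc => ?_, fun c hc d hd hdc => ?_⟩
      · by_cases hca : c = a
        · exact hca ▸ Finset.mem_insert_self _ _
        · exact Finset.mem_insert_of_mem (hV'.1 ((hmem V c hca).1 hc))
      · rcases Finset.mem_insert.1 hd with rfl | hdl
        · exact (hmema V hV).2 (hin c hc _ hbS (trans_of r hba hdc))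
        · refine (hmem V d ?_).2 (hin c hc d hdl hdc)
          rintro rfl; exact haS hdl
  unfold Lists
  rw [hdec, Finset.image_val_of_injOn hinj, Multiset.map_map, BitVectors.duplicate,
    ← Multiset.map_coe, h, Multiset.map_map]
  refine Multiset.map_congr rfl fun U hU => ?_
  have h1 : indicator l (g U) = indicator l U := by
    refine List.map_congr_left fun c hc => ?_
    have hca : c ≠ a := by rintro rfl; exact ha hc
    simp [hmem U c hca]
  rw [Function.comp_apply, Function.comp_apply, indicator_cons, h1]
  congr 1
  simp [indicator, hmema U hU, hi]

theorem exists_mem_families [IsPreorder α r] {l : List α} (hl : l.Nodup)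
    (hord : l.Pairwise fun a b => r a b → r b a)
    (hN : 3 * 2 ^ l.toFinset.card ≤ 8 * (lowerSets r l.toFinset).card) :
    ∃ L ∈ families l.length, Lists r l L := by
  induction l with
  | nil =>
    refine ⟨[[]], by simp [families], ?_⟩
    simp [Lists, lowerSets_empty, indicator]
  | cons a l ih =>
    rw [List.nodup_cons] at hl
    rw [List.pairwise_cons] at hord
    have hsub : l.toFinset ⊆ (a :: l).toFinset := by
      rw [List.toFinset_cons]; exact Finset.subset_insert _ _
    -- Heredity of the density justifies pruning the enumeration at every stage.
    obtain ⟨L, hL, hlists⟩ := ih hl.2 hord.2 (three_mul_two_pow_le_of_subset hN hsub)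
    have step : ∃ L', L' ∈ L.map (BitVectors.extend L) ++
        (List.range l.length).map (BitVectors.duplicate L) ∧ Lists r (a :: l) L' := by
      -- By the ordering of the list, the new point is equivalent to an earlier one or lies below
      -- none of them.
      by_cases hb : ∃ b ∈ l, r a b
      · obtain ⟨b, hbl, hab⟩ := hb
        obtain ⟨i, hi, h⟩ := hlists.duplicate hl.1 hbl hab (hord.1 b hbl hab)
        refine ⟨_, ?_, h⟩
        exact List.mem_append_right _ (List.mem_map_of_mem (List.mem_range.2 hi))
      · push Not at hb
        obtain ⟨d, hd, h⟩ := hlists.extend hl.1 hb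
        exact ⟨_, List.mem_append_left _ (List.mem_map_of_mem hd), h⟩
    obtain ⟨L', hL', h'⟩ := step
    refine ⟨L', ?_, h'⟩
    rw [List.length_cons, families, List.mem_filter]
    refine ⟨List.mem_flatMap.2 ⟨L, hL, hL'⟩, ?_⟩
    rw [Nat.ble_eq, len_eq, h'.length_eq]
    rwa [List.toFinset_card_of_nodup (List.nodup_cons.2 hl)] at hN

theorem exists_ordered_list [IsPreorder α r] (S : Finset α) :
    ∃ l : List α, l.Nodup ∧ l.toFinset = S ∧ l.Pairwise fun a b => r a b → r b a := by
  induction S using Finset.strongInduction with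
  | H S ih =>
    rcases S.eq_empty_or_nonempty with rfl | hS
    · exact ⟨[], by simp⟩
    -- A point with the most lower bounds is maximal up to equivalence: anything above it has the
    -- same lower bounds.
    obtain ⟨a, ha, hmax⟩ := Finset.exists_max_image S (fun a => (down r S a).card) hS
    obtain ⟨l, hnd, hl, hord⟩ := ih (S.erase a) (Finset.erase_ssubset ha)
    have hmem : ∀ b, b ∈ l ↔ b ∈ S.erase a := fun b => by rw [← hl, List.mem_toFinset]
    refine ⟨a :: l, List.nodup_cons.2 ⟨by simp [hmem], hnd⟩, ?_, List.pairwise_cons.2 ⟨?_, hord⟩⟩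
    · rw [List.toFinset_cons, hl, Finset.insert_erase ha]
    · intro b hb hab
      have hbS := (Finset.mem_erase.1 ((hmem b).1 hb)).2
      have hsub : down r S a ⊆ down r S b := fun c hc =>
        mem_down.2 ⟨(mem_down.1 hc).1, trans_of r (mem_down.1 hc).2 hab⟩
      have heq := Finset.eq_of_subset_of_card_le hsub (hmax b hbS)
      have : b ∈ down r S a := heq ▸ mem_down.2 ⟨hbS, refl_of r b⟩
      exact (mem_down.1 this).2

theorem unimodal_of_families [IsPreorder α r] {S : Finset α}
    (hfam : (families S.card).all (isPositiveUnimodal S.card) = true)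
    (hN : 3 * 2 ^ S.card ≤ 8 * (lowerSets r S).card) :
    UnimodalUpTo (lowerPoly r S) S.card := by
  obtain ⟨l, hnd, rfl, hord⟩ := exists_ordered_list (r := r) S
  obtain ⟨L, hL, hlists⟩ := exists_mem_families hnd hord hN
  rw [List.toFinset_card_of_nodup hnd] at hfam ⊢
  have h := List.all_eq_true.1 hfam L hL
  rw [isPositiveUnimodal, Bool.and_eq_true] at h
  have hzero : ∀ j, l.length < j → (lowerPoly r l.toFinset).coeff j = 0 := fun j hj =>
    coeff_lowerPoly_eq_zero (by rwa [List.toFinset_card_of_nodup hnd])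
  have hcoeff : ∀ j, (weights l.length L).getD j 0 = (lowerPoly r l.toFinset).coeff j := by
    intro j
    rw [weights]
    rcases Nat.lt_or_ge l.length j with hj | hj
    · rw [hzero j hj, List.getD_eq_default]
      simpa using hj
    · rw [List.getD_eq_getElem _ _ (by simpa using Nat.lt_succ_of_le hj)]
      simp [hlists.countWeight_eq hnd]
  refine ⟨fun j hj => ?_, hzero, ?_⟩
  · have := List.all_eq_true.1 h.1 (countWeight L j)
      (List.mem_map_of_mem (List.mem_range.2 (Nat.lt_succ_of_le hj)))
    rw [hlists.countWeight_eq hnd] at this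
    exact Nat.le_of_ble_eq_true this
  · simpa only [hcoeff] using exists_mode_of_isUnimodal h.2

/-- A preorder on at least five points with at least three eighths of all subsets as lower sets
has unimodal lower set numbers. -/
theorem unimodal_lowerPoly [IsPreorder α r] (S : Finset α) (hn : 5 ≤ S.card)
    (hN : 3 * 2 ^ S.card ≤ 8 * (lowerSets r S).card) :
    UnimodalUpTo (lowerPoly r S) S.card := by
  induction S using Finset.strongInduction with
  | H S ih =>
    rcases Nat.lt_or_ge S.card 7 with h7 | h7
    · refine unimodal_of_families ?_ hN
      obtain h | h : S.card = 5 ∨ S.card = 6 := by omega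
      · rw [h]; exact families_five
      · rw [h]; exact families_six
    · by_cases hiso : ∀ x ∈ S, ∃ y ∈ S, Adj r x y
      · exact unimodal_of_no_isolated hN h7 hiso
      · push Not at hiso
        obtain ⟨x, hx, hx'⟩ := hiso
        have hc := Finset.card_erase_add_one hx
        have := (ih (S.erase x) (Finset.erase_ssubset hx) (by omega)
          (three_mul_two_pow_le_of_subset hN (Finset.erase_subset _ _))).mul_one_add_X
        rwa [hc, ← lowerPoly_of_isolated hx hx'] at this

end LowerSets

/-! ### From lower sets back to open sets. -/

namespace LowerSets
open scoped Classical

variable {X : Type*} [Fintype X] (τ : TopologicalSpace X)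

instance : IsPreorder X (@Specializes X τ) where
  refl := fun x => @specializes_refl X τ x
  trans := fun _ _ _ h h' => @Specializes.trans X τ _ _ _ h h'

theorem mem_lowerSets_specializes (U : Finset X) :
    U ∈ lowerSets (@Specializes X τ) Finset.univ ↔ IsOpen[τ] (U : Set X) := by
  rw [mem_lowerSets, @isOpen_iff_forall_specializes X τ]
  simp only [Finset.subset_univ, true_and, Finset.mem_univ, forall_const, Finset.mem_coe]
  exact ⟨fun h x y hxy hy => h y hy x hxy, fun h a ha b hba => h b a hba ha⟩

theorem ncard_setOf_isOpen (p : ℕ → Prop) :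
    {U : Set X | IsOpen[τ] U ∧ p U.ncard}.ncard =
      ((lowerSets (@Specializes X τ) Finset.univ).filter fun U => p U.card).card := by
  have h : {U : Set X | IsOpen[τ] U ∧ p U.ncard} = (fun U : Finset X => (U : Set X)) ''
      (((lowerSets (@Specializes X τ) Finset.univ).filter fun U => p U.card :
        Finset (Finset X)) : Set (Finset X)) := by
    ext U
    simp only [Set.mem_ofPred_eq, Set.mem_image, Finset.mem_coe, Finset.mem_filter,
      mem_lowerSets_specializes]
    constructor
    · rintro ⟨hU, hp⟩
      refine ⟨U.toFinset, ⟨by simpa using hU, ?_⟩, by simp⟩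
      rwa [← Set.ncard_eq_toFinset_card']
    · rintro ⟨V, ⟨hV, hp⟩, rfl⟩
      exact ⟨hV, by rwa [Set.ncard_coe_finset]⟩
  rw [h, Set.ncard_image_of_injective _ Finset.coe_injective, Set.ncard_coe_finset]

theorem openSetCount_eq_coeff (j : ℕ) :
    openSetCount τ j = (lowerPoly (@Specializes X τ) Finset.univ).coeff j := by
  rw [openSetCount, coeff_lowerPoly]
  convert ncard_setOf_isOpen τ (· = j)

end LowerSets

theorem coeff_openSetPolynomial {X : Type*} (τ : TopologicalSpace X) (j : ℕ) :
    (openSetPolynomial τ).coeff j = if j ≤ Nat.card X then (openSetCount τ j : ℝ) else 0 := by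
  simp only [openSetPolynomial, finsetSum_coeff, coeff_C_mul, coeff_X_pow, mul_ite, mul_one,
    mul_zero, Finset.sum_ite_eq, Finset.mem_range, Nat.lt_succ_iff]

theorem isUnimodalPolynomial_of_unimodalUpTo {p : ℕ[X]} {q : ℝ[X]} {n : ℕ}
    (hp : UnimodalUpTo p n) (hq : ∀ j, q.coeff j = p.coeff j) : IsUnimodalPolynomial q := by
  obtain ⟨hpos, hzero, k, hup, hdown⟩ := hp
  have hdeg : q.natDegree = n := by
    refine le_antisymm (natDegree_le_iff_coeff_eq_zero.2 fun j hj => ?_)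
      (le_natDegree_of_ne_zero ?_)
    · rw [hq, hzero j hj, Nat.cast_zero]
    · rw [hq, Nat.cast_ne_zero]
      exact (hpos n le_rfl).ne'
  -- The coefficient drops from positive to zero after `n`, so the sequence cannot still be rising
  -- there.
  have hk : k ≤ n := by
    by_contra hk
    have h1 := hup n (by omega)
    rw [hzero (n + 1) (by omega)] at h1
    have := hpos n le_rfl
    omega
  rw [IsUnimodalPolynomial, hdeg]
  refine ⟨fun j hj => ?_, k, k, le_rfl, hk, fun j hj => ?_, fun j hj hj' => by omega,
    fun j hj _ => ?_⟩
  · rw [hq]; exact_mod_cast hpos j hj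
  · rw [hq, hq]; exact_mod_cast hup j hj
  · rw [hq, hq]; exact_mod_cast hdown j hj

theorem theorem3p19 {X : Type*} [Finite X] (n : ℕ) (hX : Nat.card X = n) (hn : 5 ≤ n)
    (τ : TopologicalSpace X) (hτ : 6 * 2 ^ (n - 4) ≤ {U : Set X | IsOpen[τ] U}.ncard) :
    IsUnimodalPolynomial (openSetPolynomial τ) := by
  classical
  have := Fintype.ofFinite X
  have hcard : (Finset.univ : Finset X).card = n := by
    rw [Finset.card_univ, ← Nat.card_eq_fintype_card, hX]
  have hcount := LowerSets.ncard_setOf_isOpen τ fun _ => True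
  simp only [and_true, Finset.filter_true] at hcount
  rw [hcount] at hτ
  have hpoly := LowerSets.unimodal_lowerPoly (r := @Specializes X τ) Finset.univ
    (by rwa [hcard]) (by
      rw [hcard]
      obtain ⟨m, rfl⟩ := Nat.exists_eq_add_of_le hn
      rw [show 5 + m - 4 = m + 1 by omega] at hτ
      -- The threshold `6 * 2 ^ (n - 4)` is 3/8 of `2 ^ n`.
      have e1 : 2 ^ (5 + m) = 32 * 2 ^ m := by ring
      have e2 : 2 ^ (m + 1) = 2 * 2 ^ m := by ring
      omega)
  refine isUnimodalPolynomial_of_unimodalUpTo hpoly fun j => ?_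
  rw [coeff_openSetPolynomial, hX, LowerSets.openSetCount_eq_coeff]
  split_ifs with hj
  · rfl
  · rw [LowerSets.coeff_lowerPoly_eq_zero (by rw [hcard]; omega), Nat.cast_zero]
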